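/- Let $\mathcal{O}_2$ be the ring of germs at $0\in\mathbb{C}^2$ of holomorphic functions and $\mathfrak{m}=\{\varphi\in\mathcal{O}_2:\varphi(0)=0\}$. For $f\in\mathcal{O}_2$ let $\nu(f)$ be its algebraic multiplicity, i.e. the largest $n$ with $f\in\mathfrak{m}^n$ (equivalently, the lowest degree of a nonzero term of its Taylor expansion), and for every integer $k\ge 0$ let \[ \mu^k(f)=\dim_{\mathbb{C}}\frac{\mathcal{O}_2}{\langle f_x,f_y\rangle\,\mathfrak{m}^k},\qquad \tau^k(f)=\dim_{\mathbb{C}}\frac{\mathcal{O}_2}{\langle f_x,f_y\rangle\,\mathfrak{m}^k+\langle f\rangle} \] be its $k$-th Milnor and Tjurina numbers. We say that $\{f=0\}$ has an isolated singularity at $0$ if $f(0)=f_x(0)=f_y(0)=0$ and $0$ is the only common zero of $f,f_x,f_y$ in some neighbourhood of $0$. (1) Let $f\in\mathbb{C}[x,y]$ be a quasi-homogeneous polynomial (there are positive rational weights of $x$ and $y$ for which every monomial of $f$ has weighted degree $1$) such that $\{f=0\}$ has an isolated singularity at $0$. Then for every integer $k$ with $0\le k<\nu(f)$ both $\mu^k(f)$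 and $\tau^k(f)$ are finite, $\tau^k(f)>0$, and \[ \frac{\mu^k(f)}{\tau^k(f)}<\frac43 . \] (2) The inequality fails for general isolated plane curve singularities and $k\ge0$: the polynomial $f=x^5+y^5+x^3y^3$ defines an isolated singularity at $0$ with $\mu^8(f)=78$ and $\tau^8(f)=50$, so that $\mu^8(f)/\tau^8(f)=78/50>4/3$. -/

import Mathlib

open Filter Topology

noncomputable section

namespace KMilnor

/-- The complex plane `ℂ²`. -/
abbrev Plane : Type := Fin 2 → ℂ

/-- `𝒪₂`: the ring of germs at `0 ∈ ℂ²` of holomorphic functions. -/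
def O₂ : Subring (Germ (𝓝 (0 : Plane)) ℂ) where
  carrier := {φ | ∃ g : Plane → ℂ, AnalyticAt ℂ g 0 ∧ φ = (g : Germ (𝓝 (0 : Plane)) ℂ)}
  mul_mem' := by
    rintro _ _ ⟨g, hg, rfl⟩ ⟨h, hh, rfl⟩
    exact ⟨g * h, hg.mul hh, rfl⟩
  one_mem' := ⟨1, analyticAt_const, rfl⟩
  add_mem' := by
    rintro _ _ ⟨g, hg, rfl⟩ ⟨h, hh, rfl⟩
    exact ⟨g + h, hg.add hh, rfl⟩
  zero_mem' := ⟨0, analyticAt_const, rfl⟩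
  neg_mem' := by
    rintro _ ⟨g, hg, rfl⟩
    exact ⟨-g, hg.neg, rfl⟩

/-- The germ at `0` of a function that is holomorphic near `0`. -/
def germ (g : Plane → ℂ) (hg : AnalyticAt ℂ g 0) : O₂ :=
  ⟨(g : Germ (𝓝 (0 : Plane)) ℂ), g, hg, rfl⟩

/-- `ℂ` sits in `𝒪₂` as the germs of constant functions. -/
instance algebraO₂ : Algebra ℂ O₂ :=
  RingHom.toAlgebra
    { toFun := fun c => germ (fun _ => c) analyticAt_const
      map_one' := rfl
      map_mul' := fun _ _ => rfl
      map_zero' := rfl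
      map_add' := fun _ _ => rfl }

/-- `𝔪`: the ideal of the germs that vanish at `0`. -/
def 𝔪 : Ideal O₂ :=
  RingHom.ker ((Germ.valueRingHom (x := (0 : Plane)) (E := ℂ)).comp O₂.subtype)

/-- The partial derivative `∂φ/∂xᵢ` of a germ `φ ∈ 𝒪₂`. -/
def partialDeriv (i : Fin 2) (φ : O₂) : O₂ :=
  ⟨Germ.liftOn (φ : Germ (𝓝 (0 : Plane)) ℂ)
      (fun g => ((fun z => fderiv ℂ g z (Pi.single i 1) : Plane → ℂ) :
        Germ (𝓝 (0 : Plane)) ℂ))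
      (fun g h hgh => Germ.coe_eq.mpr
        ((EventuallyEq.fderiv hgh).fun_comp (fun L : Plane →L[ℂ] ℂ => L (Pi.single i 1)))), by
    obtain ⟨_, g, hg, rfl⟩ := φ
    exact ⟨fun z => fderiv ℂ g z (Pi.single i 1), 
      ((ContinuousLinearMap.apply ℂ ℂ (Pi.single i 1 : Plane)).analyticAt _).comp hg.fderiv, rfl⟩⟩

/-- The Jacobian ideal `⟨φ_x, φ_y⟩` of a germ `φ ∈ 𝒪₂`. -/
def jacobianIdeal (φ : O₂) : Ideal O₂ :=
  Ideal.span {partialDeriv 0 φ, partialDeriv 1 φ}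

/-- The ideal `⟨φ_x, φ_y⟩ 𝔪ᵏ`. -/
def milnorIdeal (k : ℕ) (φ : O₂) : Ideal O₂ :=
  jacobianIdeal φ * 𝔪 ^ k

/-- The ideal `⟨φ_x, φ_y⟩ 𝔪ᵏ + ⟨φ⟩`. -/
def tjurinaIdeal (k : ℕ) (φ : O₂) : Ideal O₂ :=
  jacobianIdeal φ * 𝔪 ^ k + Ideal.span {φ}

/-- The `k`-th Milnor number `μᵏ(φ) = dim_ℂ 𝒪₂ / ⟨φ_x, φ_y⟩ 𝔪ᵏ`
(meaningful when the quotient is finite-dimensional). -/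
def milnorNumber (k : ℕ) (φ : O₂) : ℕ :=
  Module.finrank ℂ (O₂ ⧸ milnorIdeal k φ)

/-- The `k`-th Tjurina number `τᵏ(φ) = dim_ℂ 𝒪₂ / (⟨φ_x, φ_y⟩ 𝔪ᵏ + ⟨φ⟩)`
(meaningful when the quotient is finite-dimensional). -/
def tjurinaNumber (k : ℕ) (φ : O₂) : ℕ :=
  Module.finrank ℂ (O₂ ⧸ tjurinaIdeal k φ)

/-- The algebraic multiplicity `ν(φ)`: the largest `n` with `φ ∈ 𝔪ⁿ`, i.e. the lowest degree of
a nonzero term of the Taylor expansion of `φ` at `0` (`⊤` for `φ = 0`). -/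
def algMultiplicity (φ : O₂) : ℕ∞ :=
  ⨆ (n : ℕ) (_ : φ ∈ 𝔪 ^ n), (n : ℕ∞)

/-- The curve germ `{g = 0}` has an isolated singularity at `0`: it is singular at `0`, and `0` is
the only singular point of the curve near `0`. -/
def HasIsolatedSingularity (g : Plane → ℂ) : Prop :=
  g 0 = 0 ∧ fderiv ℂ g 0 = 0 ∧ ∀ᶠ z in 𝓝[≠] (0 : Plane), ¬ (g z = 0 ∧ fderiv ℂ g z = 0)

/-- A polynomial is quasi-homogeneous (weighted homogeneous): for some positive rational weights
of `x` and `y`, all its monomials have weighted degree `1`. -/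
def IsQuasiHomogeneous (f : MvPolynomial (Fin 2) ℂ) : Prop :=
  ∃ w : Fin 2 → ℚ, (∀ i, 0 < w i) ∧ f.IsWeightedHomogeneous w 1

/-- The function on `ℂ²` defined by a polynomial. -/
def polyFun (f : MvPolynomial (Fin 2) ℂ) : Plane → ℂ :=
  fun z => MvPolynomial.eval z f

/-- The germ at `0` of a polynomial in two variables. -/
def polyGerm (f : MvPolynomial (Fin 2) ℂ) : O₂ :=
  germ (polyFun f) (AnalyticOnNhd.eval_mvPolynomial f 0 (Set.mem_univ 0))

end KMilnor

end

noncomputable section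

namespace KMilnor

open Asymptotics MvPolynomial

/-! Write `J` for the Jacobian ideal and `I = J𝔪ᵏ`. Multiplication by `f` gives `μᵏ - τᵏ = dim 𝒪₂/(I
: f)` (`finrank_quotient_eq_add`), so both halves are about the colon ideal `(I : f)`, measured
against `dim 𝒪₂/𝔪ⁿ = n(n+1)/2`.

Quasi-homogeneous case: Euler's identity puts `f` in `𝔪J`, so for `k ≥ 1` the colon ideal contains
`𝔪ᵏ⁻¹` and `μᵏ - τᵏ ≤ k(k-1)/2`. As `k < ν(f)`, also `J ≤ 𝔪ᵏ`, hence `I ≤ 𝔪²ᵏ` and `μᵏ ≥ k(2k+1)`.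
Thus `4(μᵏ - τᵏ) ≤ 2k(k-1) < k(2k+1) ≤ μᵏ`. For `k = 0`, `f ∈ J` and the two numbers agree.
Finiteness holds because `J` contains a power of `𝔪`, by the weighted scaling action and the
Nullstellensatz.

Example: modulo `𝔪⁵` the partials are multiples of `x⁴` and `y⁴`, so Nakayama's lemma gives `J𝔪⁸ =
𝔪¹²`, of colength 78. Since `f` has order 5, the colon ideal is `𝔪⁷`, of colength 28, and `78 - 28 =
50`. -/

/-! ### Germs, polynomials and their derivatives -/

theorem exists_germ_eq (φ : O₂) : ∃ (g : Plane → ℂ) (hg : AnalyticAt ℂ g 0), φ = germ g hg := by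
  obtain ⟨_, g, hg, rfl⟩ := φ
  exact ⟨g, hg, rfl⟩

theorem germ_eq_germ {g h : Plane → ℂ} {hg : AnalyticAt ℂ g 0} {hh : AnalyticAt ℂ h 0} :
    germ g hg = germ h hh ↔ g =ᶠ[𝓝 0] h := by
  rw [← Germ.coe_eq]
  exact Subtype.ext_iff

theorem germ_mem_maximal {g : Plane → ℂ} {hg : AnalyticAt ℂ g 0} : germ g hg ∈ 𝔪 ↔ g 0 = 0 :=
  Iff.rfl

/-- The algebra homomorphism taking a polynomial to its germ at `0`. -/
def polyHom : MvPolynomial (Fin 2) ℂ →ₐ[ℂ] O₂ where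
  toFun := polyGerm
  map_one' := Subtype.ext (Germ.coe_eq.2 (.of_forall fun z => map_one (eval z)))
  map_zero' := Subtype.ext (Germ.coe_eq.2 (.of_forall fun z => map_zero (eval z)))
  map_mul' p q := Subtype.ext (Germ.coe_eq.2 (.of_forall fun z => map_mul (eval z) p q))
  map_add' p q := Subtype.ext (Germ.coe_eq.2 (.of_forall fun z => map_add (eval z) p q))
  commutes' c := Subtype.ext (Germ.coe_eq.2 (.of_forall fun z => eval_C (f := z) c))

theorem polyHom_apply (p : MvPolynomial (Fin 2) ℂ) : polyHom p = polyGerm p := rfl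

theorem hasFDerivAt_polyFun (p : MvPolynomial (Fin 2) ℂ) (z : Plane) :
    HasFDerivAt (polyFun p)
      (∑ i, eval z (pderiv i p) • (ContinuousLinearMap.proj i : Plane →L[ℂ] ℂ)) z := by
  induction p using MvPolynomial.induction_on with
  | C a =>
    have : polyFun (C a) = fun _ => a := by ext; simp [polyFun]
    rw [this]
    exact (hasFDerivAt_const a z).congr_fderiv (by ext; simp)
  | add p q hp hq =>
    have : polyFun (p + q) = polyFun p + polyFun q := by ext; simp [polyFun]
    rw [this]
    refine (hp.add hq).congr_fderiv ?_
    refine ContinuousLinearMap.ext fun v => ?_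
    simp [add_mul]
    ring
  | mul_X p j hp =>
    have : polyFun (p * X j) = fun z => polyFun p z * z j := by ext; simp [polyFun]
    rw [this]
    refine (hp.mul (hasFDerivAt_apply j z)).congr_fderiv ?_
    refine ContinuousLinearMap.ext fun v => ?_
    fin_cases j <;> simp [pderiv_X, polyFun] <;> ring

theorem partialDeriv_polyGerm (i : Fin 2) (p : MvPolynomial (Fin 2) ℂ) :
    partialDeriv i (polyGerm p) = polyGerm (pderiv i p) := by
  refine Subtype.ext (Germ.coe_eq.2 (.of_forall fun z => ?_))
  change fderiv ℂ (polyFun p) z (Pi.single i 1) = polyFun (pderiv i p) z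
  rw [(hasFDerivAt_polyFun p z).fderiv]
  fin_cases i <;> simp [polyFun]

theorem fderiv_polyFun_eq_zero_iff (p : MvPolynomial (Fin 2) ℂ) (z : Plane) :
    fderiv ℂ (polyFun p) z = 0 ↔ ∀ i, eval z (pderiv i p) = 0 := by
  rw [(hasFDerivAt_polyFun p z).fderiv]
  constructor
  · intro h i
    have := congrArg (fun L : Plane →L[ℂ] ℂ => L (Pi.single i 1)) h
    fin_cases i <;> simpa using this
  · intro h
    exact Finset.sum_eq_zero fun i _ => by
      rw [h i]; exact zero_smul ℂ (_ : Plane →L[ℂ] ℂ)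

/-! ### Hadamard's lemma and the maximal ideal -/

/-- Hadamard's lemma. -/
theorem exists_analyticAt_apply_self {g : Plane → ℂ} (hg : AnalyticAt ℂ g 0) :
    ∃ G : Plane → Plane →L[ℂ] ℂ, AnalyticAt ℂ G 0 ∧ ∀ᶠ z in 𝓝 0, g z = g 0 + G z z := by
  obtain ⟨p, r, hp⟩ := hg
  -- `G` is the sum of the shifted power series: the term of degree `n + 1` with its last argument
  -- split off.
  have hpos : 0 < p.shift.radius := by
    rw [FormalMultilinearSeries.radius_shift]; exact hp.r_pos.trans_le hp.r_le
  have hG := p.shift.hasFPowerSeriesOnBall hpos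
  refine ⟨p.shift.sum, hG.analyticAt, ?_⟩
  filter_upwards [Metric.eball_mem_nhds (0 : Plane) hp.r_pos,
    Metric.eball_mem_nhds (0 : Plane) hpos] with z hz hz'
  have h1 := hp.hasSum hz
  have h2 : HasSum (fun n => p.shift n (fun _ => z) z) (p.shift.sum z z) := by
    have := hG.hasSum hz'
    rw [zero_add] at this
    exact this.mapL (ContinuousLinearMap.apply ℂ ℂ z)
  rw [zero_add, ← hasSum_nat_add_iff' 1] at h1
  have h3 (n : ℕ) : p.shift n (fun _ => z) z = p (n + 1) fun _ => z := by
    change p (n + 1) (Fin.snoc (fun _ => z) z) = _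
    congr 1
    ext i
    refine Fin.lastCases ?_ (fun j => ?_) i <;> simp
  simp only [h3] at h2
  have h4 := h1.unique h2
  rw [Finset.sum_range_one, hp.coeff_zero] at h4
  rw [← h4]; ring

theorem exists_eq_add_X_mul (φ : O₂) : ∃ (c : ℂ) (a b : O₂),
    φ = algebraMap ℂ O₂ c + (polyHom (X 0) * a + polyHom (X 1) * b) ∧ (φ ∈ 𝔪 → c = 0) := by
  obtain ⟨g, hg, rfl⟩ := exists_germ_eq φ
  obtain ⟨G, hG, h⟩ := exists_analyticAt_apply_self hg
  have hc (i : Fin 2) : AnalyticAt ℂ (fun z => G z (Pi.single i 1)) 0 :=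
    ((ContinuousLinearMap.apply ℂ ℂ (Pi.single i 1 : Plane)).analyticAt _).comp hG
  refine ⟨g 0, germ _ (hc 0), germ _ (hc 1), ?_, germ_mem_maximal.1⟩
  refine Subtype.ext (Germ.coe_eq.2 (h.mono fun z hz => ?_))
  have hz' : z = z 0 • Pi.single 0 1 + z 1 • Pi.single 1 1 := by
    ext i; fin_cases i <;> simp
  rw [hz]
  change g 0 + G z z = g 0 + (eval z (X 0) * G z (Pi.single 0 1) + eval z (X 1) * G z (Pi.single 1 1))
  conv_lhs => rw [hz', map_add, map_smul, map_smul, ← hz']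
  simp

theorem polyHom_mem_maximal {p : MvPolynomial (Fin 2) ℂ} : polyHom p ∈ 𝔪 ↔ eval 0 p = 0 :=
  Iff.rfl

theorem polyHom_X_mem (i : Fin 2) : polyHom (X i) ∈ 𝔪 :=
  polyHom_mem_maximal.2 (by simp)

theorem maximal_eq_map : 𝔪 = (idealOfVars (Fin 2) ℂ).map polyHom := by
  apply le_antisymm
  · intro φ hφ
    obtain ⟨c, a, b, rfl, hc⟩ := exists_eq_add_X_mul φ
    rw [hc hφ, map_zero, zero_add]
    refine add_mem (Ideal.mul_mem_right _ _ ?_) (Ideal.mul_mem_right _ _ ?_) <;>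
      exact Ideal.mem_map_of_mem _ (Ideal.subset_span ⟨_, rfl⟩)
  · rw [idealOfVars, Ideal.map_span, Ideal.span_le]
    rintro _ ⟨_, ⟨i, rfl⟩, rfl⟩
    exact polyHom_X_mem i

theorem maximal_fg : 𝔪.FG := by
  rw [maximal_eq_map]
  exact (idealOfVars_fg _ _).map _

/-- A germ with value 1 at the origin is invertible; this makes Nakayama's lemma available. -/
theorem maximal_le_jacobson : 𝔪 ≤ Ideal.jacobson ⊥ := by
  intro φ hφ
  rw [Ideal.mem_jacobson_bot]
  intro ψ
  obtain ⟨h, hh, e⟩ := exists_germ_eq (φ * ψ + 1)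
  have h0 : h 0 = 1 := by
    have h1 : germ (fun z => h z - 1) (hh.sub analyticAt_const) ∈ 𝔪 := by
      have : germ (fun z => h z - 1) (hh.sub analyticAt_const) = germ h hh - 1 := rfl
      rw [this, ← e, add_sub_cancel_right]
      exact Ideal.mul_mem_right _ _ hφ
    exact sub_eq_zero.1 (germ_mem_maximal.1 h1)
  rw [e]
  refine IsUnit.of_mul_eq_one (germ h⁻¹ (hh.inv (by simp [h0]))) ?_
  refine Subtype.ext (Germ.coe_eq.2 ?_)
  filter_upwards [hh.continuousAt.eventually_ne (y := 0) (by simp [h0])] with z hz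
  exact mul_inv_cancel₀ hz

/-! ### Order of vanishing of polynomial germs -/

theorem exists_isBigO_of_mem_pow {n : ℕ} {φ : O₂} (hφ : φ ∈ 𝔪 ^ n) :
    ∃ (g : Plane → ℂ) (hg : AnalyticAt ℂ g 0), φ = germ g hg ∧
      g =O[𝓝 0] fun z => ‖z‖ ^ n := by
  induction n generalizing φ with
  | zero =>
    obtain ⟨g, hg, rfl⟩ := exists_germ_eq φ
    exact ⟨g, hg, rfl, by simpa using hg.continuousAt.isBigO_one ℝ⟩
  | succ n ih =>
    rw [pow_succ] at hφ
    induction hφ using Submodule.mul_induction_on' with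
    | mem_mul_mem a ha b hb =>
      obtain ⟨g, hg, rfl, hO⟩ := ih ha
      obtain ⟨h, hh, rfl⟩ := exists_germ_eq b
      have h0 : h 0 = 0 := germ_mem_maximal.1 hb
      have hO' : h =O[𝓝 0] fun z => ‖z‖ := by
        simpa [h0] using hh.differentiableAt.hasFDerivAt.isBigO_sub.norm_right
      exact ⟨g * h, hg.mul hh, rfl, by simp only [pow_succ]; exact hO.mul hO'⟩
    | add a _ b _ ha hb =>
      obtain ⟨g, hg, rfl, hO⟩ := ha
      obtain ⟨h, hh, rfl, hO'⟩ := hb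
      exact ⟨g + h, hg.add hh, rfl, hO.add hO'⟩

theorem isBigO_polyFun {n : ℕ} {p : MvPolynomial (Fin 2) ℂ} (hp : polyHom p ∈ 𝔪 ^ n) :
    polyFun p =O[𝓝 0] fun z => ‖z‖ ^ n := by
  obtain ⟨g, hg, e, hO⟩ := exists_isBigO_of_mem_pow hp
  exact (germ_eq_germ.1 (polyHom_apply p ▸ e)).trans_isBigO hO

theorem polyHom_mem_pow_of_mem {n : ℕ} {p : MvPolynomial (Fin 2) ℂ}
    (hp : p ∈ idealOfVars (Fin 2) ℂ ^ n) : polyHom p ∈ 𝔪 ^ n := by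
  rw [maximal_eq_map, ← Ideal.map_pow]
  exact Ideal.mem_map_of_mem _ hp

theorem sub_homogeneousComponent_mem {n : ℕ} {p : MvPolynomial (Fin 2) ℂ}
    (hp : p ∈ idealOfVars (Fin 2) ℂ ^ n) :
    p - homogeneousComponent n p ∈ idealOfVars (Fin 2) ℂ ^ (n + 1) := by
  rw [mem_pow_idealOfVars_iff'] at hp ⊢
  intro d hd
  rw [coeff_sub, coeff_homogeneousComponent]
  split_ifs with h
  · simp
  · rw [hp d (by omega), sub_zero]

/-- The general character `χ` covers both `t ↦ tⁿ` for ordinary degree and `expChar` for rational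
weights. -/
theorem eval_mul_of_isWeightedHomogeneous {σ R M : Type*} [CommSemiring R] [AddCommMonoid M]
    (χ : Multiplicative M →* R) {w : σ → M} {n : M} {p : MvPolynomial σ R}
    (hp : p.IsWeightedHomogeneous w n) (z : σ → R) :
    eval (fun i => χ (.ofAdd (w i)) * z i) p = χ (.ofAdd n) * eval z p := by
  rw [eval_eq, eval_eq, Finset.mul_sum]
  refine Finset.sum_congr rfl fun d hd => ?_
  have h1 : ∏ i ∈ d.support, χ (.ofAdd (w i)) ^ d i = χ (.ofAdd n) := by
    rw [← hp (mem_support_iff.1 hd), Finsupp.weight_apply, Finsupp.sum, ofAdd_sum, map_prod]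
    simp only [ofAdd_nsmul, map_pow]
  simp only [mul_pow, Finset.prod_mul_distrib, h1]
  ring

/-- On the ray `t • z` the value is `tⁿ p(z)`, yet it is bounded by a multiple of `tⁿ⁺¹`; divide by
`tⁿ` and let `t → 0`. -/
theorem eq_zero_of_isHomogeneous_of_isBigO {n : ℕ} {p : MvPolynomial (Fin 2) ℂ}
    (hp : p.IsHomogeneous n) (hO : polyFun p =O[𝓝 0] fun z => ‖z‖ ^ (n + 1)) : p = 0 := by
  refine funext fun z => ?_
  rw [map_zero]
  obtain ⟨c, hc⟩ := hO.bound
  have ht : Tendsto (fun t : ℝ => (t : ℂ) • z) (𝓝[>] 0) (𝓝 0) := by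
    have : Continuous fun t : ℝ => (t : ℂ) • z := by fun_prop
    simpa using (this.tendsto 0).mono_left nhdsWithin_le_nhds
  have hle : ∀ᶠ t : ℝ in 𝓝[>] 0, ‖eval z p‖ ≤ c * t * ‖z‖ ^ (n + 1) := by
    filter_upwards [ht.eventually hc, self_mem_nhdsWithin] with t h1 (h2 : 0 < t)
    have h3 : polyFun p ((t : ℂ) • z) = (t : ℂ) ^ n * eval z p := by
      have := eval_mul_of_isWeightedHomogeneous (powersHom ℂ (t : ℂ)) hp z
      simpa [polyFun, Pi.smul_def] using this
    rw [h3] at h1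
    simp only [norm_mul, norm_pow, Complex.norm_real, norm_smul, Real.norm_eq_abs,
      abs_of_pos h2, abs_norm] at h1
    have h4 : 0 < t ^ n := pow_pos h2 n
    refine le_of_mul_le_mul_left (h1.trans_eq ?_) h4
    ring
  have hlim : Tendsto (fun t : ℝ => c * t * ‖z‖ ^ (n + 1)) (𝓝[>] 0) (𝓝 0) := by
    have : Continuous fun t : ℝ => c * t * ‖z‖ ^ (n + 1) := by fun_prop
    simpa using (this.tendsto 0).mono_left nhdsWithin_le_nhds
  exact norm_le_zero_iff.1 (ge_of_tendsto hlim hle)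

/-- Powers of `𝔪` contract to powers of the ideal of the variables. By induction only the degree `n`
component could obstruct, and the growth bound kills it. -/
theorem polyHom_mem_pow_iff {n : ℕ} {p : MvPolynomial (Fin 2) ℂ} :
    polyHom p ∈ 𝔪 ^ n ↔ p ∈ idealOfVars (Fin 2) ℂ ^ n := by
  refine ⟨fun h => ?_, polyHom_mem_pow_of_mem⟩
  induction n with
  | zero => simp
  | succ n ih =>
    have hsub := sub_homogeneousComponent_mem (ih (Ideal.pow_le_pow_right n.le_succ h))
    have hO : polyHom (homogeneousComponent n p) ∈ 𝔪 ^ (n + 1) := by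
      have := sub_mem h (polyHom_mem_pow_of_mem hsub)
      rwa [← map_sub, sub_sub_cancel] at this
    have h0 := eq_zero_of_isHomogeneous_of_isBigO (homogeneousComponent_isHomogeneous n p)
      (isBigO_polyFun hO)
    rwa [h0, sub_zero] at hsub

/-- Iterating Hadamard's lemma produces a Taylor polynomial. -/
theorem exists_sub_polyHom_mem_pow (n : ℕ) (φ : O₂) : ∃ p, φ - polyHom p ∈ 𝔪 ^ n := by
  induction n generalizing φ with
  | zero => exact ⟨0, by simp⟩
  | succ n ih =>
    obtain ⟨c, a, b, rfl, -⟩ := exists_eq_add_X_mul φ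
    obtain ⟨p, hp⟩ := ih a
    obtain ⟨q, hq⟩ := ih b
    refine ⟨C c + (X 0 * p + X 1 * q), ?_⟩
    have hc : polyHom (C c) = algebraMap ℂ O₂ c := polyHom.commutes c
    have := add_mem (Ideal.mul_mem_mul (polyHom_X_mem 0) hp) (Ideal.mul_mem_mul (polyHom_X_mem 1) hq)
    rw [← pow_succ'] at this
    convert this using 1
    simp only [map_add, map_mul, hc]
    ring

/-! ### Colengths of ideals -/

section Quotient

variable {K A : Type*} [Field K] [CommRing A] [Algebra K A]

theorem finite_quotient_of_le {I J : Ideal A} (h : I ≤ J) [Module.Finite K (A ⧸ I)] :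
    Module.Finite K (A ⧸ J) :=
  Module.Finite.of_surjective (Ideal.Quotient.factorₐ K h).toLinearMap
    (Ideal.Quotient.factor_surjective h)

theorem finrank_quotient_le_of_le {I J : Ideal A} (h : I ≤ J) [Module.Finite K (A ⧸ I)] :
    Module.finrank K (A ⧸ J) ≤ Module.finrank K (A ⧸ I) := by
  have := (Ideal.Quotient.factorₐ K h).toLinearMap.finrank_range_le
  rwa [LinearMap.range_eq_top.2 (Ideal.Quotient.factor_surjective h), finrank_top] at this

/-- Here `J` is the colon ideal `(I : f)`; the count comes from the exact sequence `0 → A/(I : f) →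
A/I → A/(I + ⟨f⟩) → 0`, whose first map is multiplication by `f`. -/
theorem finrank_quotient_eq_add {I J : Ideal A} {f : A} (hJ : ∀ g, g ∈ J ↔ g * f ∈ I)
    [Module.Finite K (A ⧸ I)] :
    Module.finrank K (A ⧸ I) =
      Module.finrank K (A ⧸ (I + Ideal.span {f})) + Module.finrank K (A ⧸ J) := by
  let L : (A ⧸ J) →ₗ[K] (A ⧸ I) :=
    (Submodule.mapQ J I (LinearMap.toSpanSingleton A A f) fun g hg => (hJ g).1 hg).restrictScalars K
  let M : (A ⧸ I) →ₗ[K] (A ⧸ (I + Ideal.span {f})) :=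
    (Ideal.Quotient.factorₐ K (le_sup_left : I ≤ I + Ideal.span {f})).toLinearMap
  have hL : Function.Injective L := by
    rw [injective_iff_map_eq_zero]
    intro x hx
    obtain ⟨g, rfl⟩ := Ideal.Quotient.mk_surjective x
    exact Ideal.Quotient.eq_zero_iff_mem.2 ((hJ g).2 (Ideal.Quotient.eq_zero_iff_mem.1 hx))
  have hM : Function.Surjective M := Ideal.Quotient.factor_surjective le_sup_left
  have hLM : LinearMap.range L = LinearMap.ker M := by
    ext x
    obtain ⟨g, rfl⟩ := Ideal.Quotient.mk_surjective x
    constructor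
    · rintro ⟨y, hy⟩
      obtain ⟨h, rfl⟩ := Ideal.Quotient.mk_surjective y
      rw [← hy]
      exact Ideal.Quotient.eq_zero_iff_mem.2
        (Ideal.mem_sup_right (Ideal.mul_mem_left _ _ (Ideal.mem_span_singleton_self f)))
    · intro hg
      obtain ⟨a, ha, b, hb, rfl⟩ := Submodule.mem_sup.1 (Ideal.Quotient.eq_zero_iff_mem.1 hg)
      obtain ⟨c, rfl⟩ := Ideal.mem_span_singleton'.1 hb
      refine ⟨Ideal.Quotient.mk J c, (Ideal.Quotient.eq.2 ?_ :
        Ideal.Quotient.mk I (c * f) = Ideal.Quotient.mk I (a + c * f))⟩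
      rw [sub_add_cancel_right]
      exact neg_mem ha
  rw [← LinearMap.finrank_range_of_inj hL, hLM, ← M.finrank_range_add_finrank_ker,
    LinearMap.range_eq_top.2 hM, finrank_top]

end Quotient

/-! ### The dimension of `𝒪₂ / 𝔪ⁿ` -/

/-- The exponents of total degree `< n` in two variables. -/
def exponent (n : ℕ) (s : Σ i : Fin n, Fin (i + 1)) : Fin 2 →₀ ℕ :=
  Finsupp.single 0 (s.2 : ℕ) + Finsupp.single 1 ((s.1 : ℕ) - s.2)

theorem exponent_zero {n : ℕ} (s : Σ i : Fin n, Fin (i + 1)) : exponent n s 0 = s.2 := by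
  simp [exponent]

theorem exponent_one {n : ℕ} (s : Σ i : Fin n, Fin (i + 1)) : exponent n s 1 = s.1 - s.2 := by
  simp [exponent]

theorem exponent_injective (n : ℕ) : Function.Injective (exponent n) := by
  rintro ⟨i, j⟩ ⟨i', j'⟩ h
  have h0 := DFunLike.congr_fun h 0
  have h1 := DFunLike.congr_fun h 1
  simp only [exponent_zero, exponent_one] at h0 h1
  obtain rfl : i = i' := by ext; omega
  simp [Fin.ext_iff, h0]

theorem degree_eq_add (d : Fin 2 →₀ ℕ) : d.degree = d 0 + d 1 := by
  simp [Finsupp.degree_eq_sum]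

theorem degree_lt_iff {n : ℕ} {d : Fin 2 →₀ ℕ} : d.degree < n ↔ ∃ s, exponent n s = d := by
  rw [degree_eq_add]
  constructor
  · intro h
    refine ⟨⟨⟨d 0 + d 1, h⟩, ⟨d 0, by simp⟩⟩, ?_⟩
    ext i
    fin_cases i
    · simp [exponent_zero]
    · simp [exponent_one]
  · rintro ⟨s, rfl⟩
    rw [exponent_zero, exponent_one]
    omega

/-- The coefficients of the terms of degree `< n`. -/
def lowCoeffs (n : ℕ) : MvPolynomial (Fin 2) ℂ →ₗ[ℂ] (Σ i : Fin n, Fin (i + 1)) → ℂ :=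
  LinearMap.pi fun s => lcoeff ℂ (exponent n s)

theorem lowCoeffs_surjective (n : ℕ) : Function.Surjective (lowCoeffs n) := by
  intro v
  refine ⟨∑ s, monomial (exponent n s) (v s), ?_⟩
  ext t
  simp [lowCoeffs, coeff_monomial, (exponent_injective n).eq_iff]

/-- A polynomial as an element of `𝒪₂ / 𝔪ⁿ`. -/
def polyMk (n : ℕ) : MvPolynomial (Fin 2) ℂ →ₗ[ℂ] O₂ ⧸ 𝔪 ^ n :=
  ((Ideal.Quotient.mkₐ ℂ (𝔪 ^ n)).comp polyHom).toLinearMap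

theorem polyMk_surjective (n : ℕ) : Function.Surjective (polyMk n) := by
  intro x
  obtain ⟨φ, rfl⟩ := Ideal.Quotient.mk_surjective x
  obtain ⟨p, hp⟩ := exists_sub_polyHom_mem_pow n φ
  exact ⟨p, (Ideal.Quotient.eq.2 hp).symm⟩

theorem ker_polyMk_eq (n : ℕ) : LinearMap.ker (polyMk n) = LinearMap.ker (lowCoeffs n) := by
  ext p
  have h1 : polyMk n p = 0 ↔ polyHom p ∈ 𝔪 ^ n := Ideal.Quotient.eq_zero_iff_mem
  have h2 : lowCoeffs n p = 0 ↔ ∀ s, coeff (exponent n s) p = 0 := funext_iff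
  rw [LinearMap.mem_ker, LinearMap.mem_ker, h1, h2, polyHom_mem_pow_iff, mem_pow_idealOfVars_iff']
  simp only [degree_lt_iff, forall_exists_index, forall_apply_eq_imp_iff]

/-- `𝒪₂ / 𝔪ⁿ` has the monomials of degree `< n` as a basis. -/
def quotientPowEquiv (n : ℕ) : (O₂ ⧸ 𝔪 ^ n) ≃ₗ[ℂ] ((Σ i : Fin n, Fin (i + 1)) → ℂ) :=
  ((polyMk n).quotKerEquivOfSurjective (polyMk_surjective n)).symm ≪≫ₗ
    Submodule.quotEquivOfEq _ _ (ker_polyMk_eq n) ≪≫ₗ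
      (lowCoeffs n).quotKerEquivOfSurjective (lowCoeffs_surjective n)

instance finite_quotient_pow (n : ℕ) : Module.Finite ℂ (O₂ ⧸ 𝔪 ^ n) :=
  Module.Finite.equiv (quotientPowEquiv n).symm

theorem finrank_quotient_pow (n : ℕ) :
    Module.finrank ℂ (O₂ ⧸ 𝔪 ^ n) = ∑ i ∈ Finset.range n, (i + 1) := by
  rw [(quotientPowEquiv n).finrank_eq, Module.finrank_fintype_fun_eq_card, Fintype.card_sigma]
  simp only [Fintype.card_fin]
  exact Fin.sum_univ_eq_sum_range (fun i => i + 1) n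

theorem two_mul_finrank_quotient_pow (n : ℕ) :
    2 * Module.finrank ℂ (O₂ ⧸ 𝔪 ^ n) = n * (n + 1) := by
  rw [finrank_quotient_pow]
  induction n with
  | zero => simp
  | succ n ih => rw [Finset.sum_range_succ, mul_add, ih]; ring

/-! ### Additivity of the order -/

/-- The order of a product with a polynomial whose leading form has degree `s`. -/
theorem mem_pow_of_mul_mem_pow {s : ℕ} {q h : MvPolynomial (Fin 2) ℂ} (hh : h.IsHomogeneous s)
    (h0 : h ≠ 0) (hq : q - h ∈ idealOfVars (Fin 2) ℂ ^ (s + 1)) {n : ℕ}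
    {p : MvPolynomial (Fin 2) ℂ} (hp : p * q ∈ idealOfVars (Fin 2) ℂ ^ (n + s)) :
    p ∈ idealOfVars (Fin 2) ℂ ^ n := by
  induction n with
  | zero => simp
  | succ n ih =>
    have hn := ih (Ideal.pow_le_pow_right (by omega) hp)
    have hsub := sub_homogeneousComponent_mem hn
    set r := homogeneousComponent n p with hr
    have hr' : r.IsHomogeneous n := homogeneousComponent_isHomogeneous n p
    have hh' : h ∈ idealOfVars (Fin 2) ℂ ^ s := by
      rw [mem_pow_idealOfVars_iff']
      intro d hd
      exact hh.coeff_eq_zero (by omega)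
    -- `r * h` is the degree `n + s` part of `p * q`, so it vanishes; polynomials form a domain and
    -- `h ≠ 0`, hence `r = 0`.
    have h1 : r * h ∈ idealOfVars (Fin 2) ℂ ^ (n + s + 1) := by
      have e : r * h = p * q - p * (q - h) - (p - r) * h := by ring
      rw [e]
      refine sub_mem (sub_mem ?_ ?_) ?_
      · convert hp using 2; ring
      · have := Ideal.mul_mem_mul hn hq
        rwa [← pow_add] at this
      · have := Ideal.mul_mem_mul hsub hh'
        rw [← pow_add] at this
        convert this using 2; ring
    have h2 : r * h = 0 := by
      ext d
      rw [coeff_zero]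
      by_cases hd : d.degree < n + s + 1
      · exact (mem_pow_idealOfVars_iff' _ _).1 h1 d hd
      · exact (hr'.mul hh).coeff_eq_zero (by omega)
    rw [(mul_eq_zero.1 h2).resolve_right h0, sub_zero] at hsub
    exact hsub

/-- Only `φ` modulo `𝔪ⁿ⁺ˢ` matters, so it may be replaced by a polynomial. -/
theorem mem_pow_of_mul_polyHom_mem_pow {s : ℕ} {q h : MvPolynomial (Fin 2) ℂ}
    (hh : h.IsHomogeneous s) (h0 : h ≠ 0) (hq : q - h ∈ idealOfVars (Fin 2) ℂ ^ (s + 1)) {n : ℕ}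
    {φ : O₂} (hφ : φ * polyHom q ∈ 𝔪 ^ (n + s)) : φ ∈ 𝔪 ^ n := by
  obtain ⟨p, hp⟩ := exists_sub_polyHom_mem_pow (n + s) φ
  have hpn := Ideal.pow_le_pow_right (Nat.le_add_right n s) hp
  have h1 : polyHom (p * q) ∈ 𝔪 ^ (n + s) := by
    have := sub_mem hφ (Ideal.mul_mem_right (polyHom q) _ hp)
    rwa [← sub_mul, sub_sub_cancel, ← map_mul] at this
  have h2 := polyHom_mem_pow_iff.2 (mem_pow_of_mul_mem_pow hh h0 hq (polyHom_mem_pow_iff.1 h1))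
  simpa using add_mem hpn h2

/-! ### Jacobian ideals of polynomial germs -/

theorem tjurinaIdeal_eq (k : ℕ) (φ : O₂) :
    tjurinaIdeal k φ = milnorIdeal k φ + Ideal.span {φ} := rfl

theorem jacobianIdeal_polyGerm (f : MvPolynomial (Fin 2) ℂ) :
    jacobianIdeal (polyGerm f) = Ideal.span {polyHom (pderiv 0 f), polyHom (pderiv 1 f)} := by
  rw [jacobianIdeal, partialDeriv_polyGerm, partialDeriv_polyGerm]
  rfl

theorem pderiv_mem_pow {n : ℕ} {f : MvPolynomial (Fin 2) ℂ}
    (hf : f ∈ idealOfVars (Fin 2) ℂ ^ (n + 1)) (i : Fin 2) :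
    pderiv i f ∈ idealOfVars (Fin 2) ℂ ^ n := by
  rw [mem_pow_idealOfVars_iff'] at hf ⊢
  intro d hd
  rw [coeff_pderiv, hf _ (by simp [map_add, hd]), zero_mul]

theorem jacobianIdeal_le_pow {n : ℕ} {f : MvPolynomial (Fin 2) ℂ} (hf : polyGerm f ∈ 𝔪 ^ (n + 1)) :
    jacobianIdeal (polyGerm f) ≤ 𝔪 ^ n := by
  have := polyHom_mem_pow_iff.1 (polyHom_apply f ▸ hf)
  rw [jacobianIdeal_polyGerm, Ideal.span_le, Set.insert_subset_iff, Set.singleton_subset_iff]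
  exact ⟨polyHom_mem_pow_of_mem (pderiv_mem_pow this 0),
    polyHom_mem_pow_of_mem (pderiv_mem_pow this 1)⟩

theorem mem_pow_of_lt_algMultiplicity {k : ℕ} {φ : O₂} (h : (k : ℕ∞) < algMultiplicity φ) :
    φ ∈ 𝔪 ^ (k + 1) := by
  obtain ⟨n, hn⟩ := lt_iSup_iff.1 h
  obtain ⟨hφ, hk⟩ := lt_iSup_iff.1 hn
  exact Ideal.pow_le_pow_right (by exact_mod_cast hk) hφ

/-! ### Quasi-homogeneous singularities -/

/-- Euler's identity for rational weights. -/
theorem sum_smul_X_mul_pderiv {f : MvPolynomial (Fin 2) ℂ} {w : Fin 2 → ℚ}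
    (hf : f.IsWeightedHomogeneous w 1) :
    f = ∑ i, C (w i : ℂ) * (X i * pderiv i f) := by
  ext d
  have hX (i : Fin 2) : coeff d (X i * pderiv i f) = d i * coeff d f := by
    conv_lhs => rw [f.as_sum, map_sum, Finset.mul_sum, coeff_sum]
    simp only [X_mul_pderiv_monomial, coeff_smul, coeff_monomial]
    by_cases h : d ∈ f.support
    · rw [Finset.sum_eq_single d (fun b _ hb => by simp [hb]) (fun h' => absurd h h')]
      simp
    · rw [notMem_support_iff.1 h, mul_zero]
      exact Finset.sum_eq_zero fun b hb => by
        rw [if_neg (by rintro rfl; exact h hb), smul_zero]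
  simp only [coeff_sum, coeff_C_mul, hX]
  by_cases h : coeff d f = 0
  · simp [h]
  · have h1 := hf h
    rw [Finsupp.weight_apply, Finsupp.sum_fintype _ _ (by simp), Fin.sum_univ_two] at h1
    rw [Fin.sum_univ_two, ← mul_assoc, ← mul_assoc, ← add_mul]
    have h2 : (w 0 : ℂ) * d 0 + (w 1 : ℂ) * d 1 = 1 := by
      have : ((d 0 • w 0 + d 1 • w 1 : ℚ) : ℂ) = 1 := by rw [h1]; norm_num
      push_cast [nsmul_eq_mul] at this
      linear_combination this
    rw [h2, one_mul]

/-- The one-parameter group `q ↦ exp (-s q)`. -/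
def expChar (s : ℝ) : Multiplicative ℚ →* ℂ where
  toFun q := Complex.exp (-(s * (q.toAdd : ℝ) : ℝ))
  map_one' := by simp
  map_mul' a b := by
    rw [← Complex.exp_add]
    congr 1
    push_cast [toAdd_mul]
    ring

theorem tendsto_expChar {q : ℚ} (hq : 0 < q) :
    Tendsto (fun s => expChar s (.ofAdd q)) atTop (𝓝 0) := by
  rw [tendsto_zero_iff_norm_tendsto_zero]
  have : ∀ s, ‖expChar s (.ofAdd q)‖ = Real.exp (-(s * q)) := fun s => by
    change ‖Complex.exp (-(s * (q : ℝ) : ℝ))‖ = _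
    rw [Complex.norm_exp]
    simp
  simp only [this]
  exact Real.tendsto_exp_neg_atTop_nhds_zero.comp
    (tendsto_id.atTop_mul_const (by exact_mod_cast hq))

theorem expChar_ne_zero (s : ℝ) (a : Multiplicative ℚ) : expChar s a ≠ 0 := Complex.exp_ne_zero _

/-- Weighted scaling preserves the critical locus and contracts every point to the origin; by
Euler's identity `f` vanishes there too. A nonzero critical point would thus yield singular points
arbitrarily near 0. -/
theorem eq_zero_of_eval_pderiv_eq_zero {f : MvPolynomial (Fin 2) ℂ} (hf : IsQuasiHomogeneous f)
    (hs : HasIsolatedSingularity (polyFun f)) {z : Plane} (hz : ∀ i, eval z (pderiv i f) = 0) :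
    z = 0 := by
  obtain ⟨w, hw, hf⟩ := hf
  by_contra hne
  obtain ⟨j, hj⟩ : ∃ j, z j ≠ 0 := by
    by_contra! h
    exact hne (funext h)
  have hlim : Tendsto (fun (s : ℝ) (i : Fin 2) => expChar s (.ofAdd (w i)) * z i) atTop
      (𝓝[≠] (0 : Plane)) := by
    refine tendsto_nhdsWithin_iff.2 ⟨tendsto_pi_nhds.2 fun i => ?_, .of_forall fun s h => ?_⟩
    · simpa using (tendsto_expChar (hw i)).mul_const (z i)
    · exact mul_ne_zero (expChar_ne_zero _ _) hj (congrFun h j)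
  obtain ⟨s, h⟩ := (hlim.eventually hs.2.2).exists
  have hd (i : Fin 2) : eval (fun i => expChar s (.ofAdd (w i)) * z i) (pderiv i f) = 0 := by
    rw [eval_mul_of_isWeightedHomogeneous (expChar s) (hf.pderiv (sub_add_cancel 1 (w i))) z, hz i,
      mul_zero]
  refine h ⟨?_, (fderiv_polyFun_eq_zero_iff _ _).2 hd⟩
  rw [polyFun, sum_smul_X_mul_pderiv hf, map_sum]
  exact Finset.sum_eq_zero fun i _ => by rw [map_mul, map_mul, hd i, mul_zero, mul_zero]

/-- The partials have no common zero in `ℂ²` except possibly 0, so the Nullstellensatz puts the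
variables in the radical of the ideal they span; a power then maps into the Jacobian ideal. -/
theorem exists_pow_le_jacobianIdeal {f : MvPolynomial (Fin 2) ℂ} (hf : IsQuasiHomogeneous f)
    (hs : HasIsolatedSingularity (polyFun f)) : ∃ n, 𝔪 ^ n ≤ jacobianIdeal (polyGerm f) := by
  have hrad : idealOfVars (Fin 2) ℂ ≤ (Ideal.span {pderiv 0 f, pderiv 1 f}).radical := by
    rw [← vanishingIdeal_zeroLocus_eq_radical (K := ℂ), idealOfVars, Ideal.span_le]
    rintro _ ⟨i, rfl⟩ x hx
    have hx0 (j : Fin 2) : eval x (pderiv j f) = 0 := by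
      have := hx (pderiv j f) (Ideal.subset_span (by fin_cases j <;> simp))
      rwa [aeval_eq_eval] at this
    rw [eq_zero_of_eval_pderiv_eq_zero hf hs hx0]
    simp
  obtain ⟨n, hn⟩ := Ideal.exists_pow_le_of_le_radical_of_fg hrad (idealOfVars_fg _ _)
  refine ⟨n, ?_⟩
  have := Ideal.map_mono (f := polyHom) hn
  rwa [Ideal.map_pow, ← maximal_eq_map, Ideal.map_span, Set.image_pair,
    ← jacobianIdeal_polyGerm] at this

theorem jacobianIdeal_le_maximal {f : MvPolynomial (Fin 2) ℂ}
    (hs : HasIsolatedSingularity (polyFun f)) : jacobianIdeal (polyGerm f) ≤ 𝔪 := by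
  have h := (fderiv_polyFun_eq_zero_iff f 0).1 hs.2.1
  rw [jacobianIdeal_polyGerm, Ideal.span_le, Set.insert_subset_iff, Set.singleton_subset_iff]
  exact ⟨polyHom_mem_maximal.2 (h 0), polyHom_mem_maximal.2 (h 1)⟩

theorem tjurinaIdeal_ne_top {f : MvPolynomial (Fin 2) ℂ}
    (hs : HasIsolatedSingularity (polyFun f)) (k : ℕ) : tjurinaIdeal k (polyGerm f) ≠ ⊤ := by
  have h1 : tjurinaIdeal k (polyGerm f) ≤ 𝔪 :=
    sup_le (Ideal.mul_le_left.trans (jacobianIdeal_le_maximal hs))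
      ((Ideal.span_singleton_le_iff_mem _).2 (polyHom_mem_maximal.2 hs.1))
  intro h
  have h2 : polyHom 1 ∈ 𝔪 := h1 (h ▸ Submodule.mem_top)
  simpa using polyHom_mem_maximal.1 h2

theorem polyGerm_mem_mul_jacobianIdeal {f : MvPolynomial (Fin 2) ℂ} (hf : IsQuasiHomogeneous f) :
    polyGerm f ∈ 𝔪 * jacobianIdeal (polyGerm f) := by
  obtain ⟨w, -, hf⟩ := hf
  rw [jacobianIdeal_polyGerm, ← polyHom_apply]
  have : polyHom f = ∑ i, polyHom (C (w i : ℂ)) * (polyHom (X i) * polyHom (pderiv i f)) := by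
    conv_lhs => rw [sum_smul_X_mul_pderiv hf]
    simp only [map_sum, map_mul]
  rw [this]
  refine sum_mem fun i _ => Ideal.mul_mem_left _ _ (Ideal.mul_mem_mul (polyHom_X_mem i) ?_)
  exact Ideal.subset_span (by fin_cases i <;> simp)

theorem finite_milnor_of_quasiHomogeneous {f : MvPolynomial (Fin 2) ℂ} (hf : IsQuasiHomogeneous f)
    (hs : HasIsolatedSingularity (polyFun f)) (k : ℕ) :
    Module.Finite ℂ (O₂ ⧸ milnorIdeal k (polyGerm f)) := by
  obtain ⟨n, hn⟩ := exists_pow_le_jacobianIdeal hf hs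
  refine finite_quotient_of_le (I := 𝔪 ^ (n + k)) ?_
  rw [pow_add]
  exact Ideal.mul_mono_left hn

theorem milnor_tjurina_inequality {f : MvPolynomial (Fin 2) ℂ} (hf : IsQuasiHomogeneous f)
    (hs : HasIsolatedSingularity (polyFun f)) {k : ℕ}
    (hk : (k : ℕ∞) < algMultiplicity (polyGerm f)) :
    Module.Finite ℂ (O₂ ⧸ milnorIdeal k (polyGerm f)) ∧
      Module.Finite ℂ (O₂ ⧸ tjurinaIdeal k (polyGerm f)) ∧
      0 < tjurinaNumber k (polyGerm f) ∧
      3 * milnorNumber k (polyGerm f) < 4 * tjurinaNumber k (polyGerm f) := by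
  have hfin := finite_milnor_of_quasiHomogeneous hf hs k
  have hfin' : Module.Finite ℂ (O₂ ⧸ tjurinaIdeal k (polyGerm f)) :=
    finite_quotient_of_le (I := milnorIdeal k (polyGerm f)) le_sup_left
  have hpos : 0 < tjurinaNumber k (polyGerm f) := by
    have := Ideal.Quotient.nontrivial_iff.2 (tjurinaIdeal_ne_top hs k)
    exact Module.finrank_pos
  refine ⟨hfin, hfin', hpos, ?_⟩
  have hmem := polyGerm_mem_mul_jacobianIdeal hf
  obtain _ | k := k
  · have : tjurinaIdeal 0 (polyGerm f) = milnorIdeal 0 (polyGerm f) := by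
      rw [tjurinaIdeal_eq, Submodule.add_eq_sup]
      refine sup_eq_left.2 ((Ideal.span_singleton_le_iff_mem _).2 ?_)
      rw [milnorIdeal, pow_zero, mul_one]
      exact Ideal.mul_le_right hmem
    rw [tjurinaNumber, this, ← milnorNumber] at hpos ⊢
    omega
  -- From here `k + 1` plays the role of the index, so the colon ideal `J` contains `𝔪ᵏ`.
  set I := milnorIdeal (k + 1) (polyGerm f) with hI
  let J : Ideal O₂ := Submodule.comap (LinearMap.toSpanSingleton O₂ O₂ (polyGerm f)) I
  have hJ : 𝔪 ^ k ≤ J := by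
    intro g hg
    have := Ideal.mul_mem_mul hg hmem
    rw [← mul_assoc, ← pow_succ, mul_comm (𝔪 ^ (k + 1))] at this
    exact this
  have hadd : milnorNumber (k + 1) (polyGerm f) =
      tjurinaNumber (k + 1) (polyGerm f) + Module.finrank ℂ (O₂ ⧸ J) :=
    finrank_quotient_eq_add fun g => Iff.rfl
  have h1 := finrank_quotient_le_of_le (K := ℂ) hJ
  have h2 := two_mul_finrank_quotient_pow k
  have hle : I ≤ 𝔪 ^ (2 * (k + 1)) := by
    rw [two_mul, pow_add]
    exact Ideal.mul_mono_left (jacobianIdeal_le_pow (mem_pow_of_lt_algMultiplicity hk))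
  have h3 : Module.finrank ℂ (O₂ ⧸ 𝔪 ^ (2 * (k + 1))) ≤ milnorNumber (k + 1) (polyGerm f) :=
    finrank_quotient_le_of_le (K := ℂ) hle
  have h4 := two_mul_finrank_quotient_pow (2 * (k + 1))
  -- This combines `2(μ - τ) ≤ k(k+1)` with `2μ ≥ (2k+2)(2k+3)`.
  nlinarith

/-! ### The example `x⁵ + y⁵ + x³y³` -/

/-- The polynomial `x⁵ + y⁵ + x³y³`. -/
def quinticExample : MvPolynomial (Fin 2) ℂ := X 0 ^ 5 + X 1 ^ 5 + X 0 ^ 3 * X 1 ^ 3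

theorem pderiv_zero_quinticExample :
    pderiv 0 quinticExample = C 5 * X 0 ^ 4 + C 3 * (X 0 ^ 2 * X 1 ^ 3) := by
  simp [quinticExample, pderiv_X, Derivation.leibniz_pow]
  simp only [map_ofNat]
  ring

theorem pderiv_one_quinticExample :
    pderiv 1 quinticExample = C 5 * X 1 ^ 4 + C 3 * (X 0 ^ 3 * X 1 ^ 2) := by
  simp [quinticExample, pderiv_X, Derivation.leibniz_pow]
  simp only [map_ofNat]
  ring

theorem hasIsolatedSingularity_quinticExample :
    HasIsolatedSingularity (polyFun quinticExample) := by
  refine ⟨by simp [polyFun, quinticExample], ?_, ?_⟩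
  · rw [fderiv_polyFun_eq_zero_iff]
    intro i
    fin_cases i
    · simp [pderiv_zero_quinticExample]
    · simp [pderiv_one_quinticExample]
  rw [eventually_nhdsWithin_iff]
  filter_upwards [Metric.ball_mem_nhds (0 : Plane) one_pos] with z hz hne h
  rw [mem_ball_zero_iff] at hz
  have h0 := (fderiv_polyFun_eq_zero_iff _ _).1 h.2 0
  have h1 := (fderiv_polyFun_eq_zero_iff _ _).1 h.2 1
  rw [pderiv_zero_quinticExample] at h0
  rw [pderiv_one_quinticExample] at h1
  simp only [map_add, map_mul, map_pow, eval_C, eval_X] at h0 h1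
  have hz0 : z 0 ≠ 0 := by
    intro h
    have : z 1 = 0 := by simpa [h] using h1
    exact hne (by ext i; fin_cases i <;> simpa)
  have hz1 : z 1 ≠ 0 := by
    intro h
    exact hz0 (by simpa [h] using h0)
  have e0 : 5 * z 0 ^ 2 = -(3 * z 1 ^ 3) :=
    mul_left_cancel₀ (pow_ne_zero 2 hz0) (by linear_combination h0)
  have e1 : 5 * z 1 ^ 2 = -(3 * z 0 ^ 3) :=
    mul_left_cancel₀ (pow_ne_zero 2 hz1) (by linear_combination h1)
  -- Multiplying `e0` and `e1` and cancelling `(z 0 * z 1)²` leaves this; it is impossible in the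
  -- unit ball of the sup norm, where `‖z 0 * z 1‖ < 1`.
  have e : 9 * (z 0 * z 1) = 25 :=
    mul_left_cancel₀ (mul_ne_zero (pow_ne_zero 2 hz0) (pow_ne_zero 2 hz1))
      (by linear_combination -5 * z 1 ^ 2 * e0 + 3 * z 1 ^ 3 * e1)
  have hn := congrArg norm e
  simp only [norm_mul, Complex.norm_ofNat] at hn
  have n0 := (norm_le_pi_norm z 0).trans_lt hz
  have n1 := (norm_le_pi_norm z 1).trans_lt hz
  nlinarith [norm_nonneg (z 0), norm_nonneg (z 1)]

theorem isHomogeneous_quinticExample_leading :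
    (X 0 ^ 5 + X 1 ^ 5 : MvPolynomial (Fin 2) ℂ).IsHomogeneous 5 :=
  (isHomogeneous_X_pow 0 5).add (isHomogeneous_X_pow 1 5)

theorem X_mem_idealOfVars (i : Fin 2) : (X i : MvPolynomial (Fin 2) ℂ) ∈ idealOfVars (Fin 2) ℂ :=
  Ideal.subset_span ⟨i, rfl⟩

theorem X_pow_mul_X_pow_mem (i j : Fin 2) (a b : ℕ) :
    (X i ^ a * X j ^ b : MvPolynomial (Fin 2) ℂ) ∈ idealOfVars (Fin 2) ℂ ^ (a + b) := by
  rw [pow_add]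
  exact Ideal.mul_mem_mul (Ideal.pow_mem_pow (X_mem_idealOfVars i) a)
    (Ideal.pow_mem_pow (X_mem_idealOfVars j) b)

theorem quinticExample_mem_pow : polyGerm quinticExample ∈ 𝔪 ^ 5 := by
  refine polyHom_mem_pow_of_mem (add_mem (add_mem ?_ ?_) ?_)
  · exact Ideal.pow_mem_pow (X_mem_idealOfVars 0) 5
  · exact Ideal.pow_mem_pow (X_mem_idealOfVars 1) 5
  · exact Ideal.pow_le_pow_right (by norm_num) (X_pow_mul_X_pow_mem 0 1 3 3)

theorem X_pow_four_mem (i : Fin 2) :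
    polyHom (X i ^ 4) ∈ jacobianIdeal (polyGerm quinticExample) ⊔ 𝔪 ^ 5 := by
  have key {p q r : MvPolynomial (Fin 2) ℂ} (hp : polyHom p ∈ jacobianIdeal (polyGerm quinticExample))
      (h : p = C 5 * q + C 3 * r) (hr : r ∈ idealOfVars (Fin 2) ℂ ^ 5) :
      polyHom q ∈ jacobianIdeal (polyGerm quinticExample) ⊔ 𝔪 ^ 5 := by
    have hq : q = C (1 / 5) * p + C (-3 / 5) * r := by
      rw [h, mul_add, ← mul_assoc, ← mul_assoc, ← C_mul, ← C_mul, add_assoc, ← add_mul, ← C_add]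
      norm_num
    rw [hq, map_add, map_mul, map_mul]
    exact Submodule.add_mem_sup (Ideal.mul_mem_left _ _ hp)
      (Ideal.mul_mem_left _ _ (polyHom_mem_pow_of_mem hr))
  have hJ (j : Fin 2) :
      polyHom (pderiv j quinticExample) ∈ jacobianIdeal (polyGerm quinticExample) := by
    rw [jacobianIdeal_polyGerm]
    exact Ideal.subset_span (by fin_cases j <;> simp)
  fin_cases i
  · exact key (hJ 0) pderiv_zero_quinticExample (X_pow_mul_X_pow_mem 0 1 2 3)
  · exact key (hJ 1) pderiv_one_quinticExample (X_pow_mul_X_pow_mem 0 1 3 2)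

/-- Since `x⁴` and `y⁴` lie in `J + 𝔪⁵`, the ideal `𝔪¹²` lies in `J𝔪⁸ + 𝔪 · 𝔪¹²`, and Nakayama's
lemma removes the last term. -/
theorem milnorIdeal_quinticExample : milnorIdeal 8 (polyGerm quinticExample) = 𝔪 ^ 12 := by
  apply le_antisymm
  · rw [milnorIdeal, show 12 = 4 + 8 from rfl, pow_add]
    exact Ideal.mul_mono_left (jacobianIdeal_le_pow quinticExample_mem_pow)
  refine Submodule.le_of_le_smul_of_le_jacobson_bot (maximal_fg.pow) maximal_le_jacobson ?_
  have hle : (jacobianIdeal (polyGerm quinticExample) ⊔ 𝔪 ^ 5) * 𝔪 ^ 8 ≤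
      milnorIdeal 8 (polyGerm quinticExample) ⊔ 𝔪 • 𝔪 ^ 12 := by
    rw [Ideal.sup_mul, ← pow_add, smul_eq_mul, ← pow_succ']
    rfl
  refine le_trans ?_ hle
  nth_rw 1 [maximal_eq_map]
  rw [← Ideal.map_pow, pow_idealOfVars_eq_span, Ideal.map_span, Ideal.span_le]
  rintro _ ⟨_, ⟨d, hd, rfl⟩, rfl⟩
  have hd' : d 0 + d 1 = 12 := by rw [← degree_eq_add]; exact hd
  have hm : (monomial d 1 : MvPolynomial (Fin 2) ℂ) = X 0 ^ d 0 * X 1 ^ d 1 := by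
    rw [monomial_eq, Finsupp.prod_fintype _ _ (by simp), Fin.prod_univ_two, C_1, one_mul]
  simp only [hm, SetLike.mem_coe]
  -- In total degree 12 at least one exponent is at least 4.
  have hsplit : ∃ (i : Fin 2) (a b : ℕ), a + b = 8 ∧
      (X 0 ^ d 0 * X 1 ^ d 1 : MvPolynomial (Fin 2) ℂ) = X i ^ 4 * (X 0 ^ a * X 1 ^ b) := by
    rcases le_or_gt 4 (d 0) with h | h
    · refine ⟨0, d 0 - 4, d 1, by omega, ?_⟩
      rw [← mul_assoc, ← pow_add, Nat.add_sub_cancel' h]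
    · refine ⟨1, d 0, d 1 - 4, by omega, ?_⟩
      rw [mul_left_comm, ← pow_add, Nat.add_sub_cancel' (by omega)]
  obtain ⟨i, a, b, hab, e⟩ := hsplit
  rw [e, map_mul]
  exact Ideal.mul_mem_mul (X_pow_four_mem i)
    (polyHom_mem_pow_of_mem (hab ▸ X_pow_mul_X_pow_mem 0 1 a b))

theorem milnorNumber_quinticExample : milnorNumber 8 (polyGerm quinticExample) = 78 := by
  have := two_mul_finrank_quotient_pow 12
  rw [milnorNumber, milnorIdeal_quinticExample]
  omega

/-- This identifies the colon ideal: multiplying by a germ with leading form `x⁵ + y⁵` raises the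
order by exactly 5. -/
theorem mul_quinticExample_mem_iff (φ : O₂) :
    φ ∈ 𝔪 ^ 7 ↔ φ * polyGerm quinticExample ∈ 𝔪 ^ 12 := by
  constructor
  · intro h
    rw [show 12 = 7 + 5 from rfl, pow_add]
    exact Ideal.mul_mem_mul h quinticExample_mem_pow
  · refine mem_pow_of_mul_polyHom_mem_pow (s := 5) isHomogeneous_quinticExample_leading ?_ ?_
    · intro h
      have := congrArg (eval ![1, 0]) h
      simp at this
    · rw [quinticExample, add_sub_cancel_left]
      exact X_pow_mul_X_pow_mem 0 1 3 3

theorem tjurinaNumber_quinticExample : tjurinaNumber 8 (polyGerm quinticExample) = 50 := by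
  have h := finrank_quotient_eq_add (K := ℂ) mul_quinticExample_mem_iff
  have h1 := two_mul_finrank_quotient_pow 12
  have h2 := two_mul_finrank_quotient_pow 7
  rw [tjurinaNumber, tjurinaIdeal_eq, milnorIdeal_quinticExample]
  omega

end KMilnor

end

theorem mainTheorem8 :
    (∀ f : MvPolynomial (Fin 2) ℂ,
      KMilnor.IsQuasiHomogeneous f →
      KMilnor.HasIsolatedSingularity (KMilnor.polyFun f) →
      ∀ k : ℕ, (k : ℕ∞) < KMilnor.algMultiplicity (KMilnor.polyGerm f) →
        Module.Finite ℂ (KMilnor.O₂ ⧸ KMilnor.milnorIdeal k (KMilnor.polyGerm f)) ∧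
        Module.Finite ℂ (KMilnor.O₂ ⧸ KMilnor.tjurinaIdeal k (KMilnor.polyGerm f)) ∧
        0 < KMilnor.tjurinaNumber k (KMilnor.polyGerm f) ∧
        (KMilnor.milnorNumber k (KMilnor.polyGerm f) : ℝ) /
          (KMilnor.tjurinaNumber k (KMilnor.polyGerm f) : ℝ) < 4 / 3) ∧
    (∃ f : MvPolynomial (Fin 2) ℂ,
      f = MvPolynomial.X 0 ^ 5 + MvPolynomial.X 1 ^ 5 +
        MvPolynomial.X 0 ^ 3 * MvPolynomial.X 1 ^ 3 ∧
      KMilnor.HasIsolatedSingularity (KMilnor.polyFun f) ∧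
      KMilnor.milnorNumber 8 (KMilnor.polyGerm f) = 78 ∧
      KMilnor.tjurinaNumber 8 (KMilnor.polyGerm f) = 50 ∧
      (4 / 3 : ℝ) < (KMilnor.milnorNumber 8 (KMilnor.polyGerm f) : ℝ) /
        (KMilnor.tjurinaNumber 8 (KMilnor.polyGerm f) : ℝ)) := by
  refine ⟨fun f hf hs k hk => ?_, KMilnor.quinticExample, rfl,
    KMilnor.hasIsolatedSingularity_quinticExample, KMilnor.milnorNumber_quinticExample,
    KMilnor.tjurinaNumber_quinticExample, ?_⟩
  · obtain ⟨h1, h2, h3, h4⟩ := KMilnor.milnor_tjurina_inequality hf hs hk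
    refine ⟨h1, h2, h3, ?_⟩
    rw [div_lt_div_iff₀ (by exact_mod_cast h3) (by norm_num)]
    exact_mod_cast (by omega)
  · rw [KMilnor.milnorNumber_quinticExample, KMilnor.tjurinaNumber_quinticExample]
    norm_num
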